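/- Let $X=(x_{ij})$ be an $n\times n$ matrix over a field $K$. For $I,J\subseteq\{1,\dots,n\}$ with $|I|=|J|$ let $X_I^J$ be the minor with row set $I$ and column set $J$, both taken in increasing order, and put $$p_I=(-1)^{\lfloor |I|/2\rfloor}X_I^I,\qquad a_{ij|I}=(-1)^{\lceil |I|/2\rceil}X_{I\cup\{i\}}^{I\cup\{j\}}\quad(i,j\notin I,\ i\ne j),\qquad p_\emptyset=1 .$$ Let $G'_n$ be the planar graph whose nodes are the lattice points $(x,y)$ with $0\le y\le x$ and $x+y\le 2n-4$ even, and whose edges are the northeast steps $(1,1)$, southeast steps $(1,-1)$ and horizontal steps $(2,0)$ between nodes. The point $(2a-2,0)$ is called node $a$. For $i>j$ and $I=\{j+1,\dots,i-1\}$ the node $v=(i+j-3,\,i-j-1)$ is labeled $a_{ij|I}$, and the triangle with apex $v$ immediately below $v$ is labeled $p_I$; a horizontal edge carries the label of the triangle of which it is the base, i.e. $p_I$ is also the label of the horizontal edge immediately below $v$ (with midpoint $v-(0,1)$). Immediately below a node on the $x$-axis this label is $p_\emptyset=1$. Let $\mathscr S_n(a,b)$ be the set of Schröder paths from node $a$ to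 node $b$ in $G'_n$, i.e. left-to-right paths in $G'_n$ with northeast, southeast and horizontal steps. For such a path $S$, let $\alpha(S)$ be the product of the labels of the weak local maxima of $S$; $\beta(S)$ the product of the labels of the edges immediately below the weak local minima of $S$; $\gamma(S)$ the product of the labels of the horizontal edges of $S$; $\delta(S)$ the product of the labels of the nodes of $G'_n$ immediately below horizontal edges of $S$ (the node $(x+1,y-1)$ for the edge from $(x,y)$ to $(x+2,y)$; there is none if $y=0$); $\epsilon(S)$ the product of the labels of the edges immediately below the strict local maxima of $S$; and $\zeta(S)$ the product of the labels of the strict local minima of $S$ that are not endpoints of $S$. Here a vertex of $S$ is a weak (strict) local maximum if it is at least as high as (higher than) each of its neighbors on $S$, and similarly for minima; an endpoint has at most one neighbor. The weight of $S$ is $$W_{\mathscr S}(S)=\frac{\alpha(S)\,\beta(S)}{\gamma(S)\,\delta(S)\,\epsilon(S)\,\zeta(S)} .$$ **Theorem.** Let $1\le j<i\le n$. If $X$ is the generic $n\times n$ matrix, whose entries are independent indeterminates over a field $K$, then the denominators $\gamma(S)\delta(S)\epsilon(S)\zeta(S)$, $S\in\mathscr S_n(j,i-1)$, are all nonzero and,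 in the field of rational functions in these indeterminates, $$x_{ij}=\sum_{S\in\mathscr S_n(j,\,i-1)}W_{\mathscr S}(S).$$ The same identity holds in $K$ for every $n\times n$ matrix $X=(x_{ij})$ (not necessarily symmetric) over $K$ for which all these denominators are nonzero. -/

import Mathlib

namespace Schroder

/-! ### Principal and almost-principal minors -/

section Minors

variable {R : Type*} [CommRing R] {n : ℕ}

/-- The minor of `X` with row set `I` and column set `J`, where `I` and `J` have the same
cardinality and both are listed in increasing order. -/
def minor (X : Matrix (Fin n) (Fin n) R) (I J : Finset (Fin n)) (h : J.card = I.card) : R :=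
  (X.submatrix (I.orderEmbOfFin rfl) (J.orderEmbOfFin h)).det

/-- The signed principal minor `p_I = (-1)^⌊|I|/2⌋ X_I^I`. -/
def principalMinor (X : Matrix (Fin n) (Fin n) R) (I : Finset (Fin n)) : R :=
  (-1) ^ (I.card / 2) * minor X I I rfl

/-- The signed almost-principal minor `a_{ij|I} = (-1)^⌈|I|/2⌉ X_{iI}^{jI}`, with row set
`I ∪ {i}` and column set `I ∪ {j}`, for `i, j ∉ I`. -/
def almostPrincipalMinor (X : Matrix (Fin n) (Fin n) R) (i j : Fin n) (I : Finset (Fin n))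
    (hi : i ∉ I) (hj : j ∉ I) : R :=
  (-1) ^ ((I.card + 1) / 2) * minor X (insert i I) (insert j I)
    (by rw [Finset.card_insert_of_notMem hi, Finset.card_insert_of_notMem hj])

end Minors

/-! ### The labelled graph -/

/-- The row or column number, in `1, …, n`, of an element of `Fin n`. -/
def idx {n : ℕ} (i : Fin n) : ℤ := (i : ℤ) + 1

/-- The lattice point `(i + j - 3, i - j - 1)` that carries the label `a_{ij|I}`, for `i > j`
and `I = {j + 1, …, i - 1}`. -/
def position {n : ℕ} (i j : Fin n) : ℤ × ℤ := (idx i + idx j - 3, idx i - idx j - 1)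

/-- The nodes of the graph `G'_n`. -/
def IsNode (n : ℕ) (v : ℤ × ℤ) : Prop :=
  0 ≤ v.2 ∧ v.2 ≤ v.1 ∧ v.1 + v.2 ≤ 2 * (n : ℤ) - 4 ∧ Even (v.1 + v.2)

/-- The node `a` of `G'_n`, which is the lattice point `(2a - 2, 0)`. -/
def axisNode (a : ℤ) : ℤ × ℤ := (2 * a - 2, 0)

section Labels

variable {R : Type*} [CommRing R] {n : ℕ}

/-- The label of the lattice point `v`: it is `a_{ij|I}` with `I = {j + 1, …, i - 1}` for the
unique pair `i > j` whose position is `v`. The product below has exactly one factor if `v` is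
a node of `G'_n`, and it is empty (no label) otherwise. -/
def nodeLabel (X : Matrix (Fin n) (Fin n) R) (v : ℤ × ℤ) : R :=
  ∏ q : Fin n × Fin n with q.2 < q.1 ∧ position q.1 q.2 = v,
    almostPrincipalMinor X q.1 q.2 (Finset.Ioo q.2 q.1) (by simp) (by simp)

/-- The label of the horizontal edge with midpoint `m`. This edge is the base of the triangle
whose apex is the node `m + (0, 1)`, and that triangle is labelled `p_I` with
`I = {j + 1, …, i - 1}` if its apex is the position of `i > j`. For an edge that lies
immediately below the `x`-axis the label is `p_∅ = 1`. -/
def edgeLabel (X : Matrix (Fin n) (Fin n) R) (m : ℤ × ℤ) : R :=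
  ∏ q : Fin n × Fin n with q.2 < q.1 ∧ position q.1 q.2 = m + (0, 1),
    principalMinor X (Finset.Ioo q.2 q.1)

end Labels

/-! ### Schröder paths -/

/-- The three kinds of steps of a Schröder path. -/
inductive Step : Type
  | northeast
  | southeast
  | horizontal
  deriving DecidableEq

instance : Fintype Step :=
  ⟨{.northeast, .southeast, .horizontal}, by intro s; cases s <;> simp⟩

/-- The displacement of a step. -/
def Step.vec : Step → ℤ × ℤ
  | .northeast => (1, 1)
  | .southeast => (1, -1)
  | .horizontal => (2, 0)

/-- The `k`-th vertex, for `0 ≤ k ≤ S.length`, of the path that starts at the node `a` and has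
the steps `S`. -/
def vertex (a : ℤ) (S : List Step) (k : ℕ) : ℤ × ℤ :=
  axisNode a + ((S.take k).map Step.vec).sum

/-- The path with steps `S` that starts at the node `a` stays in `G'_n` and ends at the
node `b`. -/
def IsSchroderPath (n : ℕ) (a b : ℤ) (S : List Step) : Prop :=
  (∀ k ≤ S.length, IsNode n (vertex a S k)) ∧ vertex a S S.length = axisNode b

theorem length_le_sum_fst (S : List Step) :
    (S.length : ℤ) ≤ (S.map Step.vec).sum.1 := by
  induction S with
  | nil => simp
  | cons s S ih =>
    have hs : 1 ≤ s.vec.1 := by cases s <;> simp [Step.vec]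
    simp only [List.length_cons, List.map_cons, List.sum_cons, Prod.fst_add]
    push_cast
    omega

theorem finite_isSchroderPath (n : ℕ) (a b : ℤ) : {S | IsSchroderPath n a b S}.Finite := by
  refine (List.finite_length_le Step (2 * n)).subset ?_
  intro S hS
  have h0 := hS.1 0 (Nat.zero_le _)
  have h1 := hS.1 S.length le_rfl
  have h2 := length_le_sum_fst S
  simp only [IsNode, vertex, List.take_zero, List.map_nil, List.sum_nil, add_zero,
    List.take_length, Prod.fst_add, Prod.snd_add] at h0 h1
  simp only [Set.mem_ofPred_eq]
  omega

/-- The set `𝒮_n(a, b)` of all Schröder paths from node `a` to node `b` in `G'_n`. -/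
noncomputable def schroderPaths (n : ℕ) (a b : ℤ) : Finset (List Step) :=
  (finite_isSchroderPath n a b).toFinset

/-! ### The weight of a Schröder path -/

/-- The `k`-th vertex is at least as high as its neighbours on the path. -/
def IsWeakLocalMax (a : ℤ) (S : List Step) (k : ℕ) : Prop :=
  ∀ l ≤ S.length, (l + 1 = k ∨ l = k + 1) → (vertex a S l).2 ≤ (vertex a S k).2

/-- The `k`-th vertex is at least as low as its neighbours on the path. -/
def IsWeakLocalMin (a : ℤ) (S : List Step) (k : ℕ) : Prop :=
  ∀ l ≤ S.length, (l + 1 = k ∨ l = k + 1) → (vertex a S k).2 ≤ (vertex a S l).2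

/-- The `k`-th vertex is higher than its neighbours on the path. -/
def IsStrictLocalMax (a : ℤ) (S : List Step) (k : ℕ) : Prop :=
  ∀ l ≤ S.length, (l + 1 = k ∨ l = k + 1) → (vertex a S l).2 < (vertex a S k).2

/-- The `k`-th vertex is lower than its neighbours on the path. -/
def IsStrictLocalMin (a : ℤ) (S : List Step) (k : ℕ) : Prop :=
  ∀ l ≤ S.length, (l + 1 = k ∨ l = k + 1) → (vertex a S k).2 < (vertex a S l).2

instance (a : ℤ) (S : List Step) : DecidablePred (IsWeakLocalMax a S) :=
  fun _ => by unfold IsWeakLocalMax; infer_instance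

instance (a : ℤ) (S : List Step) : DecidablePred (IsWeakLocalMin a S) :=
  fun _ => by unfold IsWeakLocalMin; infer_instance

instance (a : ℤ) (S : List Step) : DecidablePred (IsStrictLocalMax a S) :=
  fun _ => by unfold IsStrictLocalMax; infer_instance

instance (a : ℤ) (S : List Step) : DecidablePred (IsStrictLocalMin a S) :=
  fun _ => by unfold IsStrictLocalMin; infer_instance

section Weight

variable {R : Type*} [CommRing R] {n : ℕ}

/-- `α(S)`: the product of the labels of the weak local maxima of the path. -/
def alphaMon (X : Matrix (Fin n) (Fin n) R) (a : ℤ) (S : List Step) : R :=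
  ∏ k ∈ Finset.range (S.length + 1) with IsWeakLocalMax a S k, nodeLabel X (vertex a S k)

/-- `β(S)`: the product of the labels of the edges immediately below the weak local minima of
the path. -/
def betaMon (X : Matrix (Fin n) (Fin n) R) (a : ℤ) (S : List Step) : R :=
  ∏ k ∈ Finset.range (S.length + 1) with IsWeakLocalMin a S k,
    edgeLabel X (vertex a S k - (0, 1))

/-- `γ(S)`: the product of the labels of the horizontal edges of the path. -/
def gammaMon (X : Matrix (Fin n) (Fin n) R) (a : ℤ) (S : List Step) : R :=
  ∏ k ∈ Finset.range S.length with S[k]? = some Step.horizontal,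
    edgeLabel X (vertex a S k + (1, 0))

/-- `δ(S)`: the product of the labels of the nodes of `G'_n` immediately below the horizontal
edges of the path. There is no such node (and `nodeLabel` is `1`) for a horizontal edge on the
`x`-axis. -/
def deltaMon (X : Matrix (Fin n) (Fin n) R) (a : ℤ) (S : List Step) : R :=
  ∏ k ∈ Finset.range S.length with S[k]? = some Step.horizontal,
    nodeLabel X (vertex a S k + (1, -1))

/-- `ε(S)`: the product of the labels of the edges immediately below the strict local maxima of
the path. -/
def epsilonMon (X : Matrix (Fin n) (Fin n) R) (a : ℤ) (S : List Step) : R :=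
  ∏ k ∈ Finset.range (S.length + 1) with IsStrictLocalMax a S k,
    edgeLabel X (vertex a S k - (0, 1))

/-- `ζ(S)`: the product of the labels of the strict local minima of the path that are not
endpoints. -/
def zetaMon (X : Matrix (Fin n) (Fin n) R) (a : ℤ) (S : List Step) : R :=
  ∏ k ∈ Finset.range (S.length + 1) with k ≠ 0 ∧ k ≠ S.length ∧ IsStrictLocalMin a S k,
    nodeLabel X (vertex a S k)

/-- The numerator `α(S) β(S)` of the weight. -/
def weightNum (X : Matrix (Fin n) (Fin n) R) (a : ℤ) (S : List Step) : R :=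
  alphaMon X a S * betaMon X a S

/-- The denominator `γ(S) δ(S) ε(S) ζ(S)` of the weight. -/
def weightDenom (X : Matrix (Fin n) (Fin n) R) (a : ℤ) (S : List Step) : R :=
  gammaMon X a S * deltaMon X a S * epsilonMon X a S * zetaMon X a S

end Weight

/-- The weight `W_𝒮(S)` of the path that starts at the node `a` and has the steps `S`. -/
def weight {K : Type*} [Field K] {n : ℕ} (X : Matrix (Fin n) (Fin n) K) (a : ℤ)
    (S : List Step) : K :=
  weightNum X a S / weightDenom X a S

/-- The generic `n × n` matrix, whose entries are independent indeterminates, over the field of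
rational functions in these indeterminates. -/
noncomputable def genericMatrix (K : Type*) [Field K] (n : ℕ) :
    Matrix (Fin n) (Fin n) (FractionRing (MvPolynomial (Fin n × Fin n) K)) :=
  (Matrix.mvPolynomialX (Fin n) (Fin n) K).map (algebraMap _ _)

end Schroder

/-! The weight of a path is local: each vertex contributes a factor depending on its incoming step
times a factor depending on its outgoing step. Regrouped by steps, the weight becomes a product of
step weights times the label of the final node (`weight_eq_pathWeight_mul`). The sum over paths is
therefore governed by a transfer recursion: the sum of step-weight products over paths to a node is
determined by the sums at its three possible predecessors (`pathSum_eq_sum`).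

This recursion is solved by determinants. With indices counted from 0, let B(j,k,m) be the minor
with rows k+1, …, k+m+1 and columns j, k+1, …, k+m. For j = k it is, up to sign, the label of the
node `gridPoint k m`; in general the path sum from node j to `gridPoint k m`, times the label there,
is the signed B(j,k,m) (`pathSum_mul_nodeLabel`). At height m = 0 and k = i-1 this minor is the
single entry in row i and column j. The identity matching the path recursion,
`borderedMinor_recursion`, comes from eliminating a common minor between two Desnanot–Jacobi
identities. The signs in the labels make all its terms positive.

The induction divides by labels, all of which are nonzero for the generic matrix. A given matrix
only has nonzero path denominators, so its case is obtained from the generic one by clearing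
denominators and specializing (`specialize_sum_div`). -/

namespace Schroder

open Matrix

/-! ### The Desnanot–Jacobi identity by column operations -/

section DesnanotJacobi

/-- The determinant of the square matrix with first column `v`, followed by the columns of `T`. -/
def colDet {R : Type*} [CommRing R] {m : ℕ} (v : Fin (m + 1) → R)
    (T : Matrix (Fin (m + 1)) (Fin m) R) : R :=
  (of fun r => vecCons (v r) (T r) : Matrix (Fin (m + 1)) (Fin (m + 1)) R).det

theorem colDet_add_mulVec {R : Type*} [CommRing R] {m : ℕ} (v : Fin (m + 1) → R)
    (T : Matrix (Fin (m + 1)) (Fin m) R) (c : Fin m → R) :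
    colDet (v + T *ᵥ c) T = colDet v T := by
  have h := det_updateCol_sum
    (of fun r => vecCons (v r) (T r) : Matrix (Fin (m + 1)) (Fin (m + 1)) R) 0 (vecCons 1 c)
  rw [cons_val_zero, one_smul] at h
  rw [colDet, colDet, ← h]
  congr 1
  ext r s
  refine Fin.cases ?_ (fun s => ?_) s
  · simp [Fin.sum_univ_succ, mulVec, dotProduct, mul_comm]
  · simp [Fin.succ_ne_zero]

theorem colDet_eq_sum {R : Type*} [CommRing R] {m : ℕ} (v : Fin (m + 1) → R)
    (T : Matrix (Fin (m + 1)) (Fin m) R) :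
    colDet v T = ∑ r : Fin (m + 1), (-1) ^ (r : ℕ) * v r * (T.submatrix r.succAbove id).det := by
  rw [colDet, det_succ_column_zero]
  rfl

/-- The Desnanot–Jacobi identity for a matrix with first columns `v`, `w`, followed by the
columns of `T`, with respect to the first two columns and the two extreme rows. -/
theorem colDet_mul_det {K : Type*} [Field K] {m : ℕ} (v w : Fin (m + 2) → K)
    (T : Matrix (Fin (m + 2)) (Fin m) K)
    (hT : (T.submatrix (fun a : Fin m => a.castSucc.succ) id).det ≠ 0) :
    colDet v (of fun r => vecCons (w r) (T r)) *
        (T.submatrix (fun a : Fin m => a.castSucc.succ) id).det =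
      colDet (v ∘ Fin.castSucc) (T.submatrix Fin.castSucc id) *
          colDet (w ∘ Fin.succ) (T.submatrix Fin.succ id) -
        colDet (w ∘ Fin.castSucc) (T.submatrix Fin.castSucc id) *
          colDet (v ∘ Fin.succ) (T.submatrix Fin.succ id) := by
  set C := T.submatrix (fun a : Fin m => a.castSucc.succ) id with hC
  -- The interior block is invertible, so a combination of the columns of `T` can be subtracted from
  -- `v` to clear all its interior entries. Each determinant with first column `v` then expands
  -- using the extreme rows alone.
  obtain ⟨c, u, hv, hu⟩ : ∃ (c : Fin m → K) (u : Fin (m + 2) → K), v = u + T *ᵥ c ∧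
      ∀ a : Fin m, u a.castSucc.succ = 0 := by
    refine ⟨C⁻¹ *ᵥ (fun a : Fin m => v a.castSucc.succ),
      v - T *ᵥ (C⁻¹ *ᵥ (fun a : Fin m => v a.castSucc.succ)), by simp, fun a => ?_⟩
    have h : C *ᵥ (C⁻¹ *ᵥ (fun a : Fin m => v a.castSucc.succ)) =
        fun a : Fin m => v a.castSucc.succ := by
      rw [mulVec_mulVec, mul_nonsing_inv _ (isUnit_iff_ne_zero.2 hT), one_mulVec]
    have ha := congrFun h a
    rw [Pi.sub_apply, sub_eq_zero]
    exact ha.symm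
  have h1 : colDet v (of fun r => vecCons (w r) (T r)) =
      u 0 * colDet (w ∘ Fin.succ) (T.submatrix Fin.succ id) +
        (-1) ^ (m + 1) * u (Fin.last (m + 1)) *
          colDet (w ∘ Fin.castSucc) (T.submatrix Fin.castSucc id) := by
    have : v = u + (of fun r => vecCons (w r) (T r)) *ᵥ vecCons 0 c := by
      rw [hv]
      ext r
      simp [mulVec, dotProduct]
    rw [this, colDet_add_mulVec, colDet_eq_sum, Fin.sum_univ_succ, Fin.sum_univ_castSucc]
    simp only [hu, mul_zero, zero_mul, Finset.sum_const_zero, zero_add, Fin.succ_last]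
    simp only [Fin.val_zero, pow_zero, one_mul, Fin.val_last, Fin.succAbove_last]
    rfl
  have h2 : colDet (v ∘ Fin.castSucc) (T.submatrix Fin.castSucc id) = u 0 * C.det := by
    have : v ∘ Fin.castSucc = u ∘ Fin.castSucc + (T.submatrix Fin.castSucc id) *ᵥ c := by
      rw [hv]; rfl
    rw [this, colDet_add_mulVec, colDet_eq_sum, Fin.sum_univ_succ]
    simp only [Function.comp_apply, ← Fin.succ_castSucc, hu, mul_zero, zero_mul,
      Finset.sum_const_zero, add_zero, hC, submatrix_submatrix, Fin.val_zero, pow_zero, one_mul]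
    rfl
  have h3 : colDet (v ∘ Fin.succ) (T.submatrix Fin.succ id) =
      (-1) ^ m * u (Fin.last (m + 1)) * C.det := by
    have : v ∘ Fin.succ = u ∘ Fin.succ + (T.submatrix Fin.succ id) *ᵥ c := by
      rw [hv]; rfl
    rw [this, colDet_add_mulVec, colDet_eq_sum, Fin.sum_univ_castSucc]
    simp only [Function.comp_apply, hu, mul_zero, zero_mul,
      Finset.sum_const_zero, zero_add, hC]
    simp [Function.comp_def]
  rw [h1, h2, h3]
  ring

end DesnanotJacobi

/-! ### Bordered minors of consecutive rows and their three-term recursion -/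

section Connected

variable {R : Type*} [CommRing R]

/-- The minor of the infinite matrix `x` with rows `k + 1, …, k + m + 1` and columns
`j, k + 1, …, k + m`. -/
def borderedMinor (x : ℕ → ℕ → R) (j k m : ℕ) : R :=
  colDet (fun a : Fin (m + 1) => x (k + 1 + a) j)
    (of fun (a : Fin (m + 1)) (b : Fin m) => x (k + 1 + a) (k + 1 + b))

/-- The minor of the infinite matrix `x` with rows and columns `k + 1, …, k + m`. -/
def diagMinor (x : ℕ → ℕ → R) (k m : ℕ) : R :=
  (of fun (a b : Fin m) => x (k + 1 + a) (k + 1 + b)).det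

theorem borderedMinor_zero (x : ℕ → ℕ → R) (j k : ℕ) : borderedMinor x j k 0 = x (k + 1) j := by
  simp [borderedMinor, colDet]

theorem diagMinor_zero (x : ℕ → ℕ → R) (k : ℕ) : diagMinor x k 0 = 1 := by
  simp [diagMinor]

/-- The minor with rows `k + 1, …, k + m + 1` and columns `j, k + 2, …, k + m + 1`. -/
def shiftedMinor (x : ℕ → ℕ → R) (j k m : ℕ) : R :=
  colDet (fun a : Fin (m + 1) => x (k + 1 + a) j)
    (of fun (a : Fin (m + 1)) (b : Fin m) => x (k + 1 + a) (k + 2 + b))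

theorem diagMinor_succ (x : ℕ → ℕ → R) (k m : ℕ) :
    diagMinor x k (m + 1) = shiftedMinor x (k + 1) k m := by
  rw [diagMinor, shiftedMinor, colDet]
  congr 1
  ext r s
  refine Fin.cases ?_ (fun s => ?_) s
  · simp
  · simp only [of_apply, cons_val_succ, Fin.val_succ]
    congr 1
    ring

variable {K : Type*} [Field K]

/-- Desnanot–Jacobi for the matrix of the larger bordered minor itself: the distinguished columns
are `j` and `k + 1`, and the interior is the diagonal block starting at `k + 2`. -/
theorem borderedMinor_succ_mul_diagMinor (x : ℕ → ℕ → K) (j k m : ℕ)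
    (h : diagMinor x (k + 1) m ≠ 0) :
    borderedMinor x j k (m + 1) * diagMinor x (k + 1) m =
      shiftedMinor x j k m * borderedMinor x (k + 1) (k + 1) m -
        diagMinor x k (m + 1) * borderedMinor x j (k + 1) m := by
  have hD : diagMinor x (k + 1) m = ((of fun (a : Fin (m + 2)) (b : Fin m) =>
      x (k + 1 + a) (k + 2 + b)).submatrix (fun a : Fin m => a.castSucc.succ) id).det := by
    rw [diagMinor]
    congr 1
    ext a b
    simp only [of_apply, submatrix_apply, id, Fin.val_succ, Fin.val_castSucc]
    congr 1
    ring
  have key := colDet_mul_det (fun a : Fin (m + 2) => x (k + 1 + a) j)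
    (fun a : Fin (m + 2) => x (k + 1 + a) (k + 1))
    (of fun (a : Fin (m + 2)) (b : Fin m) => x (k + 1 + a) (k + 2 + b)) (hD ▸ h)
  rw [← hD] at key
  have e1 : borderedMinor x j k (m + 1) = colDet (fun a : Fin (m + 2) => x (k + 1 + a) j)
      (of fun r => vecCons (x (k + 1 + r) (k + 1))
        ((of fun (a : Fin (m + 2)) (b : Fin m) => x (k + 1 + a) (k + 2 + b)) r)) := by
    rw [borderedMinor]
    congr 1
    ext r s
    refine Fin.cases ?_ (fun s => ?_) s
    · simp
    · simp only [of_apply, cons_val_succ, Fin.val_succ]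
      congr 1
      ring
  have e2 : ∀ j, borderedMinor x j (k + 1) m =
      colDet ((fun a : Fin (m + 2) => x (k + 1 + a) j) ∘ Fin.succ)
        ((of fun (a : Fin (m + 2)) (b : Fin m) => x (k + 1 + a) (k + 2 + b)).submatrix
          Fin.succ id) := by
    intro j
    rw [borderedMinor]
    congr 1
    · ext a
      simp only [Function.comp_apply, Fin.val_succ]
      congr 1
      ring
    · ext a b
      simp only [of_apply, submatrix_apply, id, Fin.val_succ]
      congr 1
      ring
  rw [e1, e2, e2, diagMinor_succ]
  exact key

/-- Expansion along a last row that is a unit vector; it reads off the minors of the enlarged matrix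
in `borderedMinor_mul_diagMinor`. -/
theorem colDet_of_last_row {R : Type*} [CommRing R] {m : ℕ} (v : Fin (m + 2) → R)
    (T : Matrix (Fin (m + 2)) (Fin (m + 1)) R) (hv : v (Fin.last (m + 1)) = 0)
    (hT : ∀ b, T (Fin.last (m + 1)) b = if b = Fin.last m then 1 else 0) :
    colDet v T = colDet (v ∘ Fin.castSucc) (T.submatrix Fin.castSucc Fin.castSucc) := by
  rw [colDet, det_succ_row _ (Fin.last (m + 1)), Fin.sum_univ_castSucc, Finset.sum_eq_zero]
  · have hl : (of fun r => vecCons (v r) (T r) : Matrix (Fin (m + 2)) (Fin (m + 2)) R)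
        (Fin.last (m + 1)) (Fin.last (m + 1)) = 1 := by
      rw [of_apply, ← Fin.succ_last, cons_val_succ, Fin.succ_last, hT, if_pos rfl]
    rw [zero_add, hl, Even.neg_one_pow ⟨_, rfl⟩, one_mul, one_mul, Fin.succAbove_last, colDet]
    congr 1
    ext r s
    refine Fin.cases ?_ (fun s => ?_) s
    · simp
    · simp
  · intro b _
    refine mul_eq_zero_of_left (mul_eq_zero_of_right _ ?_) _
    refine Fin.cases ?_ (fun b => ?_) b
    · simpa using hv
    · rw [← Fin.succ_castSucc, of_apply, cons_val_succ, hT, if_neg (Fin.castSucc_lt_last b).ne]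

/-- Here one more column than the minor on the left contains is involved, a Plücker-type relation.
It reduces to Desnanot–Jacobi after appending a unit row supported in the last column: minors
containing that row lose the last column, the others keep it. -/
theorem borderedMinor_mul_diagMinor (x : ℕ → ℕ → K) (j k m : ℕ)
    (h : diagMinor x (k + 1) (m + 1) ≠ 0) :
    borderedMinor x j k (m + 1) * diagMinor x (k + 1) (m + 1) =
      shiftedMinor x j k (m + 1) * borderedMinor x (k + 1) (k + 1) m -
        diagMinor x k (m + 2) * borderedMinor x j (k + 1) m := by
  let v : ℕ → Fin (m + 3) → K := fun j => Fin.snoc (fun a : Fin (m + 2) => x (k + 1 + a) j) 0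
  let T : Matrix (Fin (m + 3)) (Fin (m + 1)) K := of (Fin.snoc
    (fun (a : Fin (m + 2)) (b : Fin (m + 1)) => x (k + 1 + a) (k + 2 + b))
    (fun b => if b = Fin.last m then 1 else 0))
  have hv : ∀ j (a : Fin (m + 2)), v j a.castSucc = x (k + 1 + a) j := fun j a => by simp [v]
  have hvl : ∀ j, v j (Fin.last (m + 2)) = 0 := fun j => by simp [v]
  have hT : ∀ (a : Fin (m + 2)) b, T a.castSucc b = x (k + 1 + a) (k + 2 + b) :=
    fun a b => by simp [T]
  have hTl : ∀ b, T (Fin.last (m + 2)) b = if b = Fin.last m then 1 else 0 :=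
    fun b => by simp [T]
  have hD : diagMinor x (k + 1) (m + 1) =
      (T.submatrix (fun a : Fin (m + 1) => a.castSucc.succ) id).det := by
    rw [diagMinor]
    congr 1
    ext a b
    simp only [of_apply, submatrix_apply, id, Fin.succ_castSucc, hT, Fin.val_succ]
    congr 1; ring
  have key := colDet_mul_det (v j) (v (k + 1)) T (hD ▸ h)
  rw [← hD] at key
  have e1 : borderedMinor x j k (m + 1) =
      colDet (v j) (of fun r => vecCons (v (k + 1) r) (T r)) := by
    rw [colDet_of_last_row _ _ (hvl j), borderedMinor]
    · congr 1
      · ext a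
        exact (hv j a).symm
      · ext a b
        refine Fin.cases ?_ (fun b => ?_) b
        · simp [hv]
        · simp only [of_apply, submatrix_apply, ← Fin.succ_castSucc, cons_val_succ, hT,
            Fin.val_succ, Fin.val_castSucc]
          congr 1
          ring
    · intro b
      refine Fin.cases ?_ (fun b => ?_) b
      · simp [hvl, Fin.ext_iff]
      · rw [of_apply, cons_val_succ, hTl, ← Fin.succ_last]
        simp only [Fin.succ_inj]
  have e2 : ∀ j, borderedMinor x j (k + 1) m =
      colDet (v j ∘ Fin.succ) (T.submatrix Fin.succ id) := by
    intro j
    rw [colDet_of_last_row, borderedMinor]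
    · congr 1
      · ext a
        simp only [Function.comp_apply, Fin.succ_castSucc, hv, Fin.val_succ]
        congr 1
        ring
      · ext a b
        simp only [of_apply, submatrix_apply, id, Fin.succ_castSucc, hT, Fin.val_succ,
          Fin.val_castSucc]
        congr 1; ring
    · simp [hvl]
    · intro b
      simp [hTl]
  have e3 : ∀ j, shiftedMinor x j k (m + 1) =
      colDet (v j ∘ Fin.castSucc) (T.submatrix Fin.castSucc id) := by
    intro j
    rw [shiftedMinor]
    congr 1
    · ext a
      exact (hv j a).symm
    · ext a b
      simp [hT]
  rw [e1, e2, e2, e3, diagMinor_succ x k (m + 1), e3]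
  exact key

/-- The three-term recursion for bordered minors. -/
theorem borderedMinor_recursion (x : ℕ → ℕ → K) (j k m : ℕ)
    (h : diagMinor x (k + 1) (m + 1) ≠ 0) :
    borderedMinor x j (k + 1) (m + 1) * diagMinor x k (m + 2) *
        borderedMinor x (k + 1) (k + 1) m =
      borderedMinor x j (k + 1) m * borderedMinor x (k + 1) (k + 1) (m + 1) *
          diagMinor x k (m + 2) -
        borderedMinor x j k (m + 2) * diagMinor x (k + 1) (m + 1) *
          borderedMinor x (k + 1) (k + 1) m +
        borderedMinor x j k (m + 1) * diagMinor x (k + 1) (m + 1) *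
          borderedMinor x (k + 1) (k + 1) (m + 1) := by
  -- After substituting the two identities, the terms with `shiftedMinor x j k (m + 1)` cancel.
  rw [mul_assoc (borderedMinor x j k (m + 2)), mul_assoc (borderedMinor x j k (m + 1)),
    ← mul_assoc (borderedMinor x j k (m + 2)), ← mul_assoc (borderedMinor x j k (m + 1)),
    borderedMinor_succ_mul_diagMinor x j k (m + 1) h, borderedMinor_mul_diagMinor x j k m h]
  ring

theorem borderedMinor_recursion_zero (x : ℕ → ℕ → K) (j k : ℕ) :
    borderedMinor x j (k + 1) 0 * diagMinor x k 1 =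
      - borderedMinor x j k 1 + borderedMinor x j k 0 * borderedMinor x (k + 1) (k + 1) 0 := by
  simp [borderedMinor, diagMinor, colDet, det_fin_two]
  ring

end Connected

/-! ### Labels of the graph as consecutive minors -/

section Labels

variable {R : Type*} [CommRing R] {n : ℕ}

/-- The extension of a matrix by zero to an infinite matrix. -/
def extendByZero (X : Matrix (Fin n) (Fin n) R) (a b : ℕ) : R :=
  if h : a < n ∧ b < n then X ⟨a, h.1⟩ ⟨b, h.2⟩ else 0

theorem extendByZero_of_lt (X : Matrix (Fin n) (Fin n) R) {a b : ℕ} (ha : a < n) (hb : b < n) :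
    extendByZero X a b = X ⟨a, ha⟩ ⟨b, hb⟩ :=
  dif_pos ⟨ha, hb⟩

/-- The node at height `m` on the diagonal that starts at the `k`-th node of the axis, where
nodes are counted from zero. -/
def gridPoint (k m : ℕ) : ℤ × ℤ := (2 * k + m, m)

theorem gridPoint_injective {k m k' m' : ℕ} (h : gridPoint k m = gridPoint k' m') :
    k = k' ∧ m = m' := by
  simp only [gridPoint, Prod.mk.injEq] at h
  omega

theorem isNode_gridPoint {k m : ℕ} : IsNode n (gridPoint k m) ↔ k + m + 1 < n := by
  simp only [IsNode, gridPoint]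
  refine ⟨fun h => by omega, fun h => ⟨by omega, by omega, by omega, k + m, by ring⟩⟩

theorem filter_position_eq {k m : ℕ} (h : k + m + 1 < n) :
    (Finset.univ.filter fun q : Fin n × Fin n =>
        q.2 < q.1 ∧ position q.1 q.2 = gridPoint k m) =
      {(⟨k + m + 1, h⟩, ⟨k, by omega⟩)} := by
  ext ⟨i, j⟩
  simp only [Finset.mem_filter, Finset.mem_univ, true_and, Finset.mem_singleton, position, idx,
    gridPoint, Prod.mk.injEq, Fin.lt_def, Fin.ext_iff]
  omega

/-- Increasing enumerations of a finite set are unique, so any explicit one may replace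
`orderEmbOfFin`. -/
theorem minor_eq_det (X : Matrix (Fin n) (Fin n) R) (I J : Finset (Fin n)) (h : J.card = I.card)
    {m : ℕ} (hI : I.card = m) (f g : Fin m → Fin n) (hf : StrictMono f) (hg : StrictMono g)
    (hfI : ∀ a, f a ∈ I) (hgJ : ∀ a, g a ∈ J) : minor X I J h = (X.submatrix f g).det := by
  subst hI
  rw [minor, ← Finset.orderEmbOfFin_unique rfl hfI hf, ← Finset.orderEmbOfFin_unique h hgJ hg]

theorem nodeLabel_gridPoint (X : Matrix (Fin n) (Fin n) R) {k m : ℕ} (h : k + m + 1 < n) :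
    nodeLabel X (gridPoint k m) =
      (-1) ^ ((m + 1) / 2) * borderedMinor (extendByZero X) k k m := by
  rw [nodeLabel, filter_position_eq h, Finset.prod_singleton, almostPrincipalMinor]
  have hcard : (Finset.Ioo (⟨k, by omega⟩ : Fin n) ⟨k + m + 1, h⟩).card = m := by
    simp only [Fin.card_Ioo]
    omega
  rw [minor_eq_det (m := m + 1) X _ _ _ _ (fun a => ⟨k + 1 + a, by omega⟩)
    (fun a => ⟨k + a, by omega⟩), hcard, borderedMinor, colDet]
  · congr 2
    ext a b
    refine Fin.cases ?_ (fun b => ?_) b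
    · simp [extendByZero_of_lt, show k + 1 + (a : ℕ) < n by omega, show k < n by omega]
    · simp only [submatrix_apply, of_apply, cons_val_succ, Fin.val_succ]
      rw [extendByZero_of_lt X (by omega) (by omega)]
      congr 2
      ring
  · intro a b hab
    simp only [Fin.lt_def] at hab ⊢
    omega
  · intro a b hab
    simp only [Fin.lt_def] at hab ⊢
    omega
  · intro a
    simp only [Finset.mem_insert, Finset.mem_Ioo, Fin.lt_def, Fin.ext_iff]
    omega
  · intro a
    simp only [Finset.mem_insert, Finset.mem_Ioo, Fin.lt_def, Fin.ext_iff]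
    omega
  · rw [Finset.card_insert_of_notMem (by simp), hcard]

theorem edgeLabel_gridPoint (X : Matrix (Fin n) (Fin n) R) {k m : ℕ} (h : k + m + 1 < n) :
    edgeLabel X (gridPoint k m - (0, 1)) =
      (-1) ^ (m / 2) * diagMinor (extendByZero X) k m := by
  rw [edgeLabel, sub_add_cancel, filter_position_eq h, Finset.prod_singleton, principalMinor]
  have hcard : (Finset.Ioo (⟨k, by omega⟩ : Fin n) ⟨k + m + 1, h⟩).card = m := by
    simp only [Fin.card_Ioo]
    omega
  have hmem : ∀ a : Fin m, (⟨k + 1 + a, by omega⟩ : Fin n) ∈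
      Finset.Ioo (⟨k, by omega⟩ : Fin n) ⟨k + m + 1, h⟩ := by
    intro a
    simp only [Finset.mem_Ioo, Fin.lt_def]
    omega
  have hmono : StrictMono fun a : Fin m => (⟨k + 1 + a, by omega⟩ : Fin n) :=
    fun a b hab => by
      simp only [Fin.lt_def] at hab ⊢
      omega
  rw [minor_eq_det X _ _ _ hcard _ _ hmono hmono hmem hmem, hcard, diagMinor]
  congr 2
  ext a b
  exact (extendByZero_of_lt X (by omega) (by omega)).symm

theorem nodeLabel_of_neg (X : Matrix (Fin n) (Fin n) R) {v : ℤ × ℤ} (hv : v.2 < 0) :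
    nodeLabel X v = 1 := by
  rw [nodeLabel, Finset.filter_false_of_mem, Finset.prod_empty]
  rintro ⟨i, j⟩ - ⟨hij, rfl⟩
  simp only [position, idx, Fin.lt_def] at hv hij
  omega

end Labels

/-! ### Compatibility with ring homomorphisms -/

section Map

variable {R S : Type*} [CommRing R] [CommRing S] {n : ℕ} (f : R →+* S)
  (X : Matrix (Fin n) (Fin n) R)

theorem minor_map (I J : Finset (Fin n)) (h : J.card = I.card) :
    minor (X.map f) I J h = f (minor X I J h) := by
  rw [minor, minor, RingHom.map_det]
  rfl

theorem nodeLabel_map (v : ℤ × ℤ) : nodeLabel (X.map f) v = f (nodeLabel X v) := by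
  simp [nodeLabel, almostPrincipalMinor, minor_map, map_prod]

theorem edgeLabel_map (v : ℤ × ℤ) : edgeLabel (X.map f) v = f (edgeLabel X v) := by
  simp [edgeLabel, principalMinor, minor_map, map_prod]

theorem weightNum_map (a : ℤ) (P : List Step) :
    weightNum (X.map f) a P = f (weightNum X a P) := by
  simp [weightNum, alphaMon, betaMon, nodeLabel_map, edgeLabel_map, map_prod]

theorem weightDenom_map (a : ℤ) (P : List Step) :
    weightDenom (X.map f) a P = f (weightDenom X a P) := by
  simp [weightDenom, gammaMon, deltaMon, epsilonMon, zetaMon, nodeLabel_map, edgeLabel_map,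
    map_prod]

end Map

/-! ### Labels of the generic matrix do not vanish -/

section Generic

variable (R : Type*) [CommRing R] {n : ℕ}

/-- A submatrix of the generic matrix is a smaller generic matrix with its variables renamed
injectively. -/
theorem det_mvPolynomialX_submatrix_ne_zero [Nontrivial R] {m : ℕ} (f g : Fin m ↪ Fin n) :
    ((mvPolynomialX (Fin n) (Fin n) R).submatrix f g).det ≠ 0 := by
  have h : (mvPolynomialX (Fin n) (Fin n) R).submatrix f g =
      (MvPolynomial.rename (R := R) (Prod.map f g)).toRingHom.mapMatrix
        (mvPolynomialX (Fin m) (Fin m) R) := by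
    ext a b
    simp
  rw [h, ← RingHom.map_det]
  refine fun h0 => det_mvPolynomialX_ne_zero (Fin m) R
    (MvPolynomial.rename_injective _ (f.injective.prodMap g.injective) ?_)
  rw [map_zero]
  exact h0

theorem minor_mvPolynomialX_ne_zero [Nontrivial R] (I J : Finset (Fin n))
    (h : J.card = I.card) : minor (mvPolynomialX (Fin n) (Fin n) R) I J h ≠ 0 :=
  det_mvPolynomialX_submatrix_ne_zero R (I.orderEmbOfFin rfl).toEmbedding
    (J.orderEmbOfFin h).toEmbedding

theorem nodeLabel_mvPolynomialX_ne_zero [IsDomain R] (v : ℤ × ℤ) :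
    nodeLabel (mvPolynomialX (Fin n) (Fin n) R) v ≠ 0 :=
  Finset.prod_ne_zero_iff.2 fun _ _ => mul_ne_zero (pow_ne_zero _ (neg_ne_zero.2 one_ne_zero))
    (minor_mvPolynomialX_ne_zero R _ _ _)

theorem edgeLabel_mvPolynomialX_ne_zero [IsDomain R] (v : ℤ × ℤ) :
    edgeLabel (mvPolynomialX (Fin n) (Fin n) R) v ≠ 0 :=
  Finset.prod_ne_zero_iff.2 fun _ _ => mul_ne_zero (pow_ne_zero _ (neg_ne_zero.2 one_ne_zero))
    (minor_mvPolynomialX_ne_zero R _ _ _)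

theorem weightDenom_ne_zero [IsDomain R] (X : Matrix (Fin n) (Fin n) R)
    (hN : ∀ v, nodeLabel X v ≠ 0) (hE : ∀ v, edgeLabel X v ≠ 0) (a : ℤ) (P : List Step) :
    weightDenom X a P ≠ 0 := by
  simp only [weightDenom, gammaMon, deltaMon, epsilonMon, zetaMon]
  refine mul_ne_zero (mul_ne_zero (mul_ne_zero ?_ ?_) ?_) ?_ <;>
    exact Finset.prod_ne_zero_iff.2 fun _ _ => by first | exact hN _ | exact hE _

end Generic

/-! ### Paths to an arbitrary lattice point, and removal of the last step -/

section Paths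

theorem vertex_zero (a : ℤ) (S : List Step) : vertex a S 0 = axisNode a := by
  simp [vertex]

theorem vertex_succ (a : ℤ) (S : List Step) {k : ℕ} {s : Step} (h : S[k]? = some s) :
    vertex a S (k + 1) = vertex a S k + s.vec := by
  rw [vertex, vertex, List.take_add_one, h]
  simp [add_assoc]

theorem vertex_append (a : ℤ) (S T : List Step) {k : ℕ} (h : k ≤ S.length) :
    vertex a (S ++ T) k = vertex a S k := by
  rw [vertex, vertex, List.take_append_of_le_length h]

theorem vertex_concat_length (a : ℤ) (S : List Step) (s : Step) :
    vertex a (S ++ [s]) (S.length + 1) = vertex a S S.length + s.vec := by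
  rw [vertex_succ a _ (s := s) (by simp), vertex_append a _ _ le_rfl]

/-- Each step weakly increases `x - y`, so no path reaches a diagonal to the left of its start. -/
theorem sum_vec_snd_le (S : List Step) :
    (S.map Step.vec).sum.2 ≤ (S.map Step.vec).sum.1 := by
  induction S with
  | nil => simp
  | cons s S ih =>
    have hs : s.vec.2 ≤ s.vec.1 := by cases s <;> simp [Step.vec]
    simp only [List.map_cons, List.sum_cons, Prod.fst_add, Prod.snd_add]
    omega

/-- The path with steps `S` that starts at the node `a` stays in `G'_n` and ends at `v`. -/
def IsPathTo (n : ℕ) (a : ℤ) (v : ℤ × ℤ) (S : List Step) : Prop :=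
  (∀ k ≤ S.length, IsNode n (vertex a S k)) ∧ vertex a S S.length = v

variable {n : ℕ} {a : ℤ} {v : ℤ × ℤ} {S : List Step}

theorem IsPathTo.isNode (h : IsPathTo n a v S) : IsNode n v :=
  h.2 ▸ h.1 _ le_rfl

theorem IsPathTo.sum_eq (h : IsPathTo n a v S) : (S.map Step.vec).sum = v - axisNode a := by
  rw [← h.2, vertex, List.take_length, add_sub_cancel_left]

theorem IsPathTo.length_le (h : IsPathTo n a v S) : (S.length : ℤ) ≤ v.1 - (2 * a - 2) := by
  have h1 := length_le_sum_fst S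
  rwa [h.sum_eq] at h1

theorem IsPathTo.le_sub (h : IsPathTo n a v S) : 2 * a - 2 ≤ v.1 - v.2 := by
  have h1 := sum_vec_snd_le S
  simp only [h.sum_eq, axisNode, Prod.fst_sub, Prod.snd_sub] at h1
  omega

theorem isPathTo_concat {s : Step} :
    IsPathTo n a v (S ++ [s]) ↔ IsPathTo n a (v - s.vec) S ∧ IsNode n v := by
  constructor
  · intro h
    refine ⟨⟨fun k hk => ?_, ?_⟩, h.isNode⟩
    · rw [← vertex_append a S [s] hk]
      exact h.1 k (by simp; omega)
    · rw [← h.2, List.length_append, List.length_singleton, vertex_concat_length,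
        add_sub_cancel_right]
  · rintro ⟨h, hv⟩
    have he : vertex a (S ++ [s]) (S.length + 1) = v := by
      rw [vertex_concat_length, h.2, sub_add_cancel]
    refine ⟨fun k hk => ?_, by simpa using he⟩
    rw [List.length_append, List.length_singleton] at hk
    rcases hk.lt_or_eq with hk | rfl
    · rw [vertex_append a S [s] (by omega)]
      exact h.1 k (by omega)
    · rwa [he]

theorem finite_isPathTo (n : ℕ) (a : ℤ) (v : ℤ × ℤ) : {S | IsPathTo n a v S}.Finite := by
  refine (List.finite_length_le Step (v.1 - (2 * a - 2)).toNat).subset fun S hS => ?_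
  have h : IsPathTo n a v S := hS
  have := h.length_le
  simp only [Set.mem_ofPred_eq]
  omega

/-- The set of all paths in `G'_n` from the node `a` to `v`. -/
noncomputable def pathsTo (n : ℕ) (a : ℤ) (v : ℤ × ℤ) : Finset (List Step) :=
  (finite_isPathTo n a v).toFinset

theorem mem_pathsTo : S ∈ pathsTo n a v ↔ IsPathTo n a v S := by
  simp [pathsTo]

theorem schroderPaths_eq_pathsTo (n : ℕ) (a b : ℤ) :
    schroderPaths n a b = pathsTo n a (axisNode b) := by
  ext S
  simp only [schroderPaths, pathsTo, Set.Finite.mem_toFinset]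
  rfl

end Paths

/-! ### Factorization of the path weight over steps -/

section StepWeights

variable {K : Type*} [Field K] {n : ℕ} (X : Matrix (Fin n) (Fin n) K)

/-- The contribution of the incoming step, if any, to the weight of the vertex `v`. -/
def inFactor (v : ℤ × ℤ) : Option Step → K
  | none => 1
  | some .northeast => 1
  | some .horizontal => edgeLabel X (v - (0, 1))
  | some .southeast => edgeLabel X (v - (0, 1)) / nodeLabel X v

/-- The contribution of the outgoing step, if any, to the weight of the vertex `v`. -/
def outFactor (v : ℤ × ℤ) : Option Step → K
  | none => nodeLabel X v
  | some .northeast => 1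
  | some .horizontal => nodeLabel X v
  | some .southeast => nodeLabel X v / edgeLabel X (v - (0, 1))

/-- The weight of the step `s` that starts at `v`. -/
def stepWeight (v : ℤ × ℤ) (s : Step) : K :=
  outFactor X v (some s) * inFactor X (v + s.vec) (some s) /
    if s = .horizontal then edgeLabel X (v + (1, 0)) * nodeLabel X (v + (1, -1)) else 1

/-- The product of the weights of the steps of a path. -/
def pathWeight (a : ℤ) (S : List Step) : K :=
  ∏ k ∈ Finset.range S.length, S[k]?.elim 1 (stepWeight X (vertex a S k))

theorem pathWeight_nil (a : ℤ) : pathWeight X a [] = 1 := by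
  simp [pathWeight]

theorem pathWeight_concat (a : ℤ) (S : List Step) (s : Step) :
    pathWeight X a (S ++ [s]) =
      pathWeight X a S * stepWeight X (vertex a S S.length) s := by
  rw [pathWeight, List.length_append, List.length_singleton, Finset.prod_range_succ, pathWeight]
  congr 1
  · refine Finset.prod_congr rfl fun k hk => ?_
    have hk := Finset.mem_range.1 hk
    rw [vertex_append a _ _ hk.le, List.getElem?_append_left hk]
  · rw [vertex_append a _ _ le_rfl]
    simp

variable {X}

theorem forall_neighbor_iff {p : ℕ → Prop} {k N : ℕ} :
    (∀ l ≤ N, (l + 1 = k ∨ l = k + 1) → p l) ↔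
      (∀ l ≤ N, l + 1 = k → p l) ∧ (k + 1 ≤ N → p (k + 1)) := by
  constructor
  · exact fun h => ⟨fun l hl hk => h l hl (.inl hk), fun hk => h _ hk (.inr rfl)⟩
  · rintro ⟨h1, h2⟩ l hl (hk | rfl)
    · exact h1 l hl hk
    · exact h2 hl

/-- The weight of the `k`-th vertex of a path factors into the contributions of the two steps
at this vertex. -/
theorem vertex_factor (hN : ∀ v, nodeLabel X v ≠ 0) (hE : ∀ v, edgeLabel X v ≠ 0) {a : ℤ}
    {S : List Step} {k : ℕ} (hk : k ≤ S.length)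
    (h1 : k = 0 ∨ k = S.length → edgeLabel X (vertex a S k - (0, 1)) = 1) :
    ((if IsWeakLocalMax a S k then nodeLabel X (vertex a S k) else 1) *
        if IsWeakLocalMin a S k then edgeLabel X (vertex a S k - (0, 1)) else 1) /
      ((if IsStrictLocalMax a S k then edgeLabel X (vertex a S k - (0, 1)) else 1) *
        if k ≠ 0 ∧ k ≠ S.length ∧ IsStrictLocalMin a S k then nodeLabel X (vertex a S k)
        else 1) =
      inFactor X (vertex a S k) (if k = 0 then none else S[k - 1]?) *
        outFactor X (vertex a S k) S[k]? := by
  simp only [IsWeakLocalMax, IsWeakLocalMin, IsStrictLocalMax, IsStrictLocalMin,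
    forall_neighbor_iff]
  have hNv := hN (vertex a S k)
  have hEv := hE (vertex a S k - (0, 1))
  have hout : S[k]? = none ∧ k = S.length ∨ ∃ s, S[k]? = some s ∧ k < S.length := by
    rcases hk.lt_or_eq with h | h
    · exact .inr ⟨S[k], List.getElem?_eq_getElem h, h⟩
    · exact .inl ⟨by simp [h], h⟩
  have hin : k = 0 ∨ ∃ l s, k = l + 1 ∧ S[l]? = some s := by
    rcases k with _ | l
    · exact .inl rfl
    · exact .inr ⟨l, S[l], rfl, List.getElem?_eq_getElem (by omega)⟩
  rcases hin with h0 | ⟨l, s, rfl, hs⟩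
  · rw [if_pos h0]
    have hl : ∀ p : ℕ → Prop, (∀ l ≤ S.length, l + 1 = k → p l) ↔ True := fun p =>
      iff_true_intro fun l _ h => by omega
    have e1 := h1 (.inl h0)
    have h0' : (k ≠ 0) = False := by simp [h0]
    rcases hout with ⟨ho, hlen⟩ | ⟨t, ho, hlen⟩
    · have hlen' : ¬ k + 1 ≤ S.length := by omega
      simp only [hl (fun l => (vertex a S l).2 ≤ (vertex a S k).2),
        hl (fun l => (vertex a S k).2 ≤ (vertex a S l).2),
        hl (fun l => (vertex a S l).2 < (vertex a S k).2), ho, e1, hlen', h0']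
      simp [inFactor, outFactor]
    · have hlen' : k + 1 ≤ S.length := hlen
      simp only [vertex_succ a S ho, hl (fun l => (vertex a S l).2 ≤ (vertex a S k).2),
        hl (fun l => (vertex a S k).2 ≤ (vertex a S l).2),
        hl (fun l => (vertex a S l).2 < (vertex a S k).2), ho, e1, hlen', h0']
      cases t <;> simp [Step.vec, inFactor, outFactor, e1]
  · have hl : ∀ p : ℕ → Prop, (∀ l' ≤ S.length, l' + 1 = l + 1 → p l') ↔ p l := fun p =>
      ⟨fun h => h l (by omega) rfl, fun h l' _ hl' => by rwa [Nat.succ_injective hl']⟩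
    simp only [hl (fun i => (vertex a S i).2 ≤ (vertex a S (l + 1)).2),
        hl (fun i => (vertex a S (l + 1)).2 ≤ (vertex a S i).2),
        hl (fun i => (vertex a S i).2 < (vertex a S (l + 1)).2),
        hl (fun i => (vertex a S (l + 1)).2 < (vertex a S i).2)]
    have hv : (vertex a S (l + 1)).2 = (vertex a S l).2 + s.vec.2 := by
      rw [vertex_succ a S hs, Prod.snd_add]
    rcases hout with ⟨ho, hlen⟩ | ⟨t, ho, hlen⟩
    · have e1 := h1 (.inr hlen)
      have : ¬ l + 1 + 1 ≤ S.length := by omega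
      have hlen' : (l + 1 ≠ S.length) = False := by simp [hlen]
      simp only [hv, this, ho, hlen', e1, Nat.succ_ne_zero, if_false, Nat.add_sub_cancel, hs]
      cases s <;> simp [Step.vec, inFactor, outFactor, e1, hNv]
    · have hlen' : l + 1 + 1 ≤ S.length := hlen
      have hv' : (vertex a S (l + 1 + 1)).2 = (vertex a S (l + 1)).2 + t.vec.2 := by
        rw [vertex_succ a S ho, Prod.snd_add]
      simp only [hv', ho, hlen']
      simp only [hv]
      -- At an interior vertex, all nine pairs of incoming and outgoing steps are checked.
      cases s <;> cases t <;> simp [Step.vec, inFactor, outFactor, hs, hlen.ne] <;> field_simp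

/-- The hypotheses on the edges below the two endpoints absorb the boundary discrepancies: an
endpoint counts as an extremum on the evidence of at most one neighbor. -/
theorem weight_eq_pathWeight_mul (hN : ∀ v, nodeLabel X v ≠ 0) (hE : ∀ v, edgeLabel X v ≠ 0)
    {a : ℤ} {S : List Step} (h0 : edgeLabel X (axisNode a - (0, 1)) = 1)
    (h1 : edgeLabel X (vertex a S S.length - (0, 1)) = 1) :
    weight X a S = pathWeight X a S * nodeLabel X (vertex a S S.length) := by
  have hw : weight X a S =
      (∏ k ∈ Finset.range (S.length + 1),
        inFactor X (vertex a S k) (if k = 0 then none else S[k - 1]?) *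
          outFactor X (vertex a S k) S[k]?) /
      ∏ k ∈ Finset.range S.length, if S[k]? = some Step.horizontal then
        edgeLabel X (vertex a S k + (1, 0)) * nodeLabel X (vertex a S k + (1, -1)) else 1 := by
    have hf : ∀ k ∈ Finset.range (S.length + 1), _ := fun k hk =>
      vertex_factor hN hE (a := a) (S := S) (k := k) (by simpa [Nat.lt_succ_iff] using hk) (by
        rintro (rfl | rfl)
        · rwa [vertex_zero]
        · exact h1)
    rw [← Finset.prod_congr rfl hf, Finset.prod_div_distrib, Finset.prod_mul_distrib,
      Finset.prod_mul_distrib, ← Finset.prod_filter, ← Finset.prod_filter, ← Finset.prod_filter,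
      ← Finset.prod_filter, ← Finset.prod_filter, Finset.prod_mul_distrib, div_div]
    simp only [weight, weightNum, weightDenom, alphaMon, betaMon, gammaMon, deltaMon, epsilonMon,
      zetaMon]
    congr 1
    ring
  -- Shifting the incoming factors by one index pairs both products by steps. What remains is the
  -- incoming factor 1 at the start and the label of the last vertex.
  rw [hw, Finset.prod_mul_distrib, Finset.prod_range_succ', Finset.prod_range_succ (fun k =>
    outFactor X (vertex a S k) S[k]?), pathWeight]
  have hs : ∀ k ∈ Finset.range S.length, S[k]?.elim 1 (stepWeight X (vertex a S k)) =
      inFactor X (vertex a S (k + 1)) S[k]? * outFactor X (vertex a S k) S[k]? /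
        if S[k]? = some Step.horizontal then
        edgeLabel X (vertex a S k + (1, 0)) * nodeLabel X (vertex a S k + (1, -1)) else 1 := by
    intro k hk
    have hk' := List.getElem?_eq_getElem (Finset.mem_range.1 hk)
    rw [vertex_succ a S hk', hk']
    simp only [Option.elim_some, stepWeight, Option.some_inj, mul_comm]
  rw [Finset.prod_congr rfl hs, Finset.prod_div_distrib, Finset.prod_mul_distrib]
  simp [inFactor, outFactor]
  ring

end StepWeights

/-! ### Path sums and their transfer recursion -/

section PathSum

variable {K : Type*} [Field K] {n : ℕ} (X : Matrix (Fin n) (Fin n) K)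

/-- The sum of the products of step weights of all paths from the node `a` to `v`. -/
noncomputable def pathSum (a : ℤ) (v : ℤ × ℤ) : K :=
  ∑ S ∈ pathsTo n a v, pathWeight X a S

theorem pathSum_of_not_isNode {a : ℤ} {v : ℤ × ℤ} (hv : ¬ IsNode n v) : pathSum X a v = 0 :=
  Finset.sum_eq_zero fun _ hS => absurd (mem_pathsTo.1 hS).isNode hv

theorem pathSum_of_sub_lt {a : ℤ} {v : ℤ × ℤ} (hv : v.1 - v.2 < 2 * a - 2) :
    pathSum X a v = 0 :=
  Finset.sum_eq_zero fun _ hS => absurd (mem_pathsTo.1 hS).le_sub hv.not_ge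

theorem pathSum_axisNode {a : ℤ} (ha : IsNode n (axisNode a)) :
    pathSum X a (axisNode a) = 1 := by
  have h : pathsTo n a (axisNode a) = {[]} := by
    ext S
    rw [mem_pathsTo, Finset.mem_singleton]
    constructor
    · intro h
      have := h.length_le
      simp only [axisNode] at this
      exact List.length_eq_zero_iff.1 (by omega)
    · rintro rfl
      exact ⟨fun k _ => by simpa [vertex] using ha, by simp [vertex]⟩
  rw [pathSum, h, Finset.sum_singleton, pathWeight_nil]

theorem pathSum_eq_sum {a : ℤ} {v : ℤ × ℤ} (hv : IsNode n v) (hva : v ≠ axisNode a) :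
    pathSum X a v = ∑ s : Step, pathSum X a (v - s.vec) * stepWeight X (v - s.vec) s := by
  simp only [pathSum, Finset.sum_mul]
  rw [Finset.sum_sigma']
  refine (Finset.sum_bij (fun p _ => p.2 ++ [p.1]) ?_ ?_ ?_ ?_).symm
  · rintro ⟨s, T⟩ h
    simp only [Finset.mem_sigma, Finset.mem_univ, true_and, mem_pathsTo] at h ⊢
    exact isPathTo_concat.2 ⟨h, hv⟩
  · rintro ⟨s, T⟩ _ ⟨s', T'⟩ _ h
    obtain ⟨rfl, h⟩ := List.append_inj' h rfl
    simp_all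
  · intro S hS
    rw [mem_pathsTo] at hS
    rcases List.eq_nil_or_concat' S with rfl | ⟨T, s, rfl⟩
    · exact absurd (by simpa [vertex] using hS.2.symm) hva
    · exact ⟨⟨s, T⟩, by simpa [mem_pathsTo] using (isPathTo_concat.1 hS).1, rfl⟩
  · rintro ⟨s, T⟩ h
    simp only [Finset.mem_sigma, Finset.mem_univ, true_and, mem_pathsTo] at h
    rw [pathWeight_concat, h.2]

theorem sum_step {M : Type*} [AddCommMonoid M] (f : Step → M) :
    ∑ s, f s = f .northeast + f .southeast + f .horizontal := by
  rw [show (Finset.univ : Finset Step) = {.northeast, .southeast, .horizontal} by rfl,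
    Finset.sum_insert (by simp), Finset.sum_insert (by simp), Finset.sum_singleton, add_assoc]

end PathSum

/-! ### Solving the transfer recursion by bordered minors -/

section Recursion

variable {K : Type*} [Field K]

/-- The recursion for bordered minors, with signs. -/
theorem signed_borderedMinor_recursion (x : ℕ → ℕ → K) (j k m : ℕ)
    (h : diagMinor x (k + 1) (m + 1) ≠ 0) :
    ((-1) ^ ((m + 2) / 2) * borderedMinor x j (k + 1) (m + 1)) *
        ((-1) ^ ((m + 2) / 2) * diagMinor x k (m + 2)) *
        ((-1) ^ ((m + 1) / 2) * borderedMinor x (k + 1) (k + 1) m) =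
      ((-1) ^ ((m + 1) / 2) * borderedMinor x j (k + 1) m) *
          ((-1) ^ ((m + 2) / 2) * borderedMinor x (k + 1) (k + 1) (m + 1)) *
          ((-1) ^ ((m + 2) / 2) * diagMinor x k (m + 2)) +
        ((-1) ^ ((m + 3) / 2) * borderedMinor x j k (m + 2)) *
          ((-1) ^ ((m + 1) / 2) * diagMinor x (k + 1) (m + 1)) *
          ((-1) ^ ((m + 1) / 2) * borderedMinor x (k + 1) (k + 1) m) +
        ((-1) ^ ((m + 2) / 2) * borderedMinor x j k (m + 1)) *
          ((-1) ^ ((m + 1) / 2) * diagMinor x (k + 1) (m + 1)) *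
          ((-1) ^ ((m + 2) / 2) * borderedMinor x (k + 1) (k + 1) (m + 1)) := by
  have key := borderedMinor_recursion x j k m h
  -- This extra factor -1 turns the one negative term of the unsigned recursion positive.
  have e : (m + 3) / 2 = (m + 1) / 2 + 1 := by omega
  rw [e, pow_succ]
  have h1 : ((-1 : K) ^ ((m + 1) / 2)) ^ 2 = 1 := by rw [← pow_mul, mul_comm, pow_mul]; simp
  have h2 : ((-1 : K) ^ ((m + 2) / 2)) ^ 2 = 1 := by rw [← pow_mul, mul_comm, pow_mul]; simp
  generalize (-1 : K) ^ ((m + 1) / 2) = u at *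
  generalize (-1 : K) ^ ((m + 2) / 2) = t at *
  have h3 : t * t * u = u := by rw [← sq, h2, one_mul]
  have h4 : u * u * u = u := by rw [← sq, h1, one_mul]
  linear_combination u * key +
    (borderedMinor x j (k + 1) (m + 1) * diagMinor x k (m + 2) *
        borderedMinor x (k + 1) (k + 1) m -
      borderedMinor x j (k + 1) m * borderedMinor x (k + 1) (k + 1) (m + 1) *
          diagMinor x k (m + 2) -
      borderedMinor x j k (m + 1) * diagMinor x (k + 1) (m + 1) *
          borderedMinor x (k + 1) (k + 1) (m + 1)) * h3 +
    borderedMinor x j k (m + 2) * diagMinor x (k + 1) (m + 1) *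
          borderedMinor x (k + 1) (k + 1) m * h4

variable {n : ℕ} {X : Matrix (Fin n) (Fin n) K}

theorem axisNode_add_one (j : ℕ) : axisNode ((j : ℤ) + 1) = gridPoint j 0 := by
  ext
  · simp [axisNode, gridPoint]
    ring
  · simp [axisNode, gridPoint]

theorem edgeLabel_axis (X : Matrix (Fin n) (Fin n) K) {k : ℕ} (h : k + 1 < n) :
    edgeLabel X (gridPoint k 0 - (0, 1)) = 1 := by
  rw [edgeLabel_gridPoint X h, diagMinor_zero]
  simp

/-- Only the all-northeast path stays on the starting diagonal, and northeast steps have weight 1.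
-/
theorem pathSum_diagonal {j m : ℕ} (hm : j + m + 1 < n) :
    pathSum X ((j : ℤ) + 1) (gridPoint j m) = 1 := by
  induction m with
  | zero =>
    rw [← axisNode_add_one]
    refine pathSum_axisNode X ?_
    rw [axisNode_add_one]
    exact isNode_gridPoint.2 hm
  | succ m ih =>
    rw [pathSum_eq_sum X (isNode_gridPoint.2 hm), sum_step, pathSum_of_sub_lt (v := _ - Step.vec
      .southeast), pathSum_of_sub_lt (v := _ - Step.vec .horizontal)]
    · have e : gridPoint j (m + 1) - Step.vec .northeast = gridPoint j m := by
        ext <;> simp [gridPoint, Step.vec]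
        ring
      rw [e, ih (by omega)]
      simp [stepWeight, outFactor, inFactor]
    · simp only [gridPoint, Step.vec, Prod.fst_sub, Prod.snd_sub]
      push_cast
      omega
    · simp only [gridPoint, Step.vec, Prod.fst_sub, Prod.snd_sub]
      push_cast
      omega
    · rw [axisNode_add_one]
      exact fun h => by simpa using (gridPoint_injective h).2

/-- The path sums are ratios of bordered minors. -/
theorem pathSum_mul_nodeLabel (hN : ∀ v, nodeLabel X v ≠ 0) (hE : ∀ v, edgeLabel X v ≠ 0)
    {j k m : ℕ} (hjk : j ≤ k) (hm : k + m + 1 < n) :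
    pathSum X ((j : ℤ) + 1) (gridPoint k m) * nodeLabel X (gridPoint k m) =
      (-1) ^ ((m + 1) / 2) * borderedMinor (extendByZero X) j k m := by
  induction k, hjk using Nat.le_induction generalizing m with
  | base => rw [pathSum_diagonal hm, one_mul, nodeLabel_gridPoint X hm]
  | succ k hjk ihk =>
    have hse : ∀ m, gridPoint (k + 1) m - Step.vec .southeast = gridPoint k (m + 1) := by
      intro m
      ext <;> simp [gridPoint, Step.vec]
      ring
    have hho : ∀ m, gridPoint (k + 1) m - Step.vec .horizontal = gridPoint k m := by
      intro m
      ext <;> simp [gridPoint, Step.vec]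
      ring
    have hse' : ∀ m, gridPoint k (m + 1) + Step.vec .southeast = gridPoint (k + 1) m :=
      fun m => by rw [← hse, sub_add_cancel]
    have hho' : ∀ m, gridPoint k m + Step.vec .horizontal = gridPoint (k + 1) m :=
      fun m => by rw [← hho, sub_add_cancel]
    -- The horizontal edge leaving a node is the edge immediately below that node's northeast
    -- neighbor.
    have hup : ∀ m, gridPoint k m + (1, 0) = gridPoint k (m + 1) - (0, 1) := by
      intro m
      ext <;> simp [gridPoint]
      ring
    have hne : gridPoint (k + 1) m ≠ axisNode ((j : ℤ) + 1) := by
      rw [axisNode_add_one]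
      intro h
      have := (gridPoint_injective h).1
      omega
    induction m with
    | zero =>
      -- On the axis there is no northeast predecessor, and neither the axis edges' lower nodes nor
      -- the diagonal minor of size 0 contribute: two terms remain.
      have ih1 := ihk (m := 1) (by omega)
      have ih0 := ihk (m := 0) (by omega)
      have e0 : ¬ IsNode n (gridPoint (k + 1) 0 - Step.vec .northeast) := by
        simp [IsNode, gridPoint, Step.vec]
      have edown : nodeLabel X (gridPoint k 0 + (1, -1)) = 1 :=
        nodeLabel_of_neg X (by simp [gridPoint])
      rw [pathSum_eq_sum X (isNode_gridPoint (k := k + 1).2 hm) hne, sum_step,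
        pathSum_of_not_isNode X e0,
        hse, hho]
      simp only [stepWeight, outFactor, inFactor, hse', hho', hup, edown,
        edgeLabel_axis X (show k + 1 + 1 < n by omega), if_true, reduceCtorEq, if_false]
      have hE1 := hE (gridPoint k 1 - (0, 1))
      have hN1 := hN (gridPoint (k + 1) 0)
      have key := borderedMinor_recursion_zero (extendByZero X) j k
      have eE := edgeLabel_gridPoint X (k := k) (m := 1) (by omega)
      have eN := nodeLabel_gridPoint X (k := k + 1) (m := 0) (by omega)
      norm_num at ih1 ih0 eE eN ⊢
      rw [← eE, ← eN] at key
      field_simp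
      linear_combination ih1 + nodeLabel X (gridPoint (k + 1) 0) * ih0 - key
    | succ m ih =>
      -- The southeast and horizontal predecessors lie on the previous diagonal (outer induction),
      -- the northeast one lies lower on the same diagonal (inner induction).
      have ih1 := ihk (m := m + 2) (by omega)
      have ih0 := ihk (m := m + 1) (by omega)
      have ih2 := ih (by omega) (by
        rw [axisNode_add_one]
        intro h
        have := (gridPoint_injective h).1
        omega)
      have e0 : gridPoint (k + 1) (m + 1) - Step.vec .northeast = gridPoint (k + 1) m := by
        ext <;> simp [gridPoint, Step.vec]
        ring
      have edown : gridPoint k (m + 1) + (1, -1) = gridPoint (k + 1) m := hse' m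
      rw [pathSum_eq_sum X (isNode_gridPoint.2 hm) hne, sum_step, e0, hse, hho]
      simp only [stepWeight, outFactor, inFactor, hse', hho', hup, edown,
        if_true, reduceCtorEq, if_false]
      have hE1 := hE (gridPoint k (m + 2) - (0, 1))
      have hN1 := hN (gridPoint (k + 1) m)
      have hN2 := hN (gridPoint (k + 1) (m + 1))
      have hE2 := hE (gridPoint (k + 1) (m + 1) - (0, 1))
      have eE2 := edgeLabel_gridPoint X (k := k + 1) (m := m + 1) (by omega)
      have key := signed_borderedMinor_recursion (extendByZero X) j k m
        (right_ne_zero_of_mul (eE2 ▸ hE2))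
      rw [← edgeLabel_gridPoint X (by omega), ← nodeLabel_gridPoint X (by omega), ← eE2,
        ← nodeLabel_gridPoint X (by omega), ← ih0, ← ih1, ← ih2] at key
      -- The cancelled factors are the labels of the horizontal edge and of the node below it, the
      -- denominator of the horizontal step weight.
      refine mul_right_cancel₀ (mul_ne_zero hE1 hN1) (Eq.trans ?_
        ((mul_assoc _ _ _).symm.trans key).symm)
      field_simp

theorem axisNode_idx_sub_one {i : Fin n} {l : ℕ} (h : (i : ℕ) = l + 1) :
    axisNode (idx i - 1) = gridPoint l 0 := by
  rw [← axisNode_add_one]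
  congr 1
  simp only [idx]
  omega

/-- The path formula for the entries below the diagonal of a matrix all of whose labels are
nonzero. -/
theorem sum_weight_eq (hN : ∀ v, nodeLabel X v ≠ 0) (hE : ∀ v, edgeLabel X v ≠ 0)
    {i j : Fin n} (hij : j < i) :
    X i j = ∑ S ∈ schroderPaths n (idx j) (idx i - 1), weight X (idx j) S := by
  obtain ⟨l, hl⟩ : ∃ l, (i : ℕ) = l + 1 := ⟨i - 1, by omega⟩
  have hi := i.isLt
  have hjl : (j : ℕ) ≤ l := by omega
  rw [schroderPaths_eq_pathsTo, axisNode_idx_sub_one hl]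
  have h : ∀ S ∈ pathsTo n (idx j) (gridPoint l 0),
      weight X (idx j) S = pathWeight X (idx j) S * nodeLabel X (gridPoint l 0) := by
    intro S hS
    have hS' := (mem_pathsTo.1 hS).2
    rw [weight_eq_pathWeight_mul hN hE, hS']
    · rw [idx, axisNode_add_one]
      exact edgeLabel_axis X (by omega)
    · rw [hS']
      exact edgeLabel_axis X (by omega)
  rw [Finset.sum_congr rfl h, ← Finset.sum_mul]
  have key := pathSum_mul_nodeLabel hN hE hjl (m := 0) (by omega)
  rw [borderedMinor_zero, extendByZero_of_lt X (by omega) (by omega)] at key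
  refine Eq.trans ?_ key.symm
  simp only [← hl]
  simp

end Recursion

/-! ### Specialization of identities between sums of fractions -/

section Specialize

variable {ι A L K : Type*} [CommRing A] [Field L] [Field K]

open Classical in
theorem sum_div_mul_prod (φ : A →+* L) (s : Finset ι) (p q : ι → A)
    (hφ : ∀ a ∈ s, φ (q a) ≠ 0) :
    (∑ a ∈ s, φ (p a) / φ (q a)) * φ (∏ a ∈ s, q a) =
      φ (∑ a ∈ s, p a * ∏ b ∈ s.erase a, q b) := by
  rw [Finset.sum_mul, map_sum]
  refine Finset.sum_congr rfl fun a ha => ?_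
  rw [← Finset.mul_prod_erase s q ha, map_mul, map_mul, ← mul_assoc, div_mul_cancel₀ _ (hφ a ha)]

/-- An expression as a sum of fractions that holds after an injective base change specializes
wherever the denominators do not vanish. -/
theorem specialize_sum_div {f : A →+* L} (hf : Function.Injective f) (g : A →+* K)
    (s : Finset ι) (x : A) (p q : ι → A) (hL : ∀ a ∈ s, f (q a) ≠ 0)
    (hK : ∀ a ∈ s, g (q a) ≠ 0) (h : f x = ∑ a ∈ s, f (p a) / f (q a)) :
    g x = ∑ a ∈ s, g (p a) / g (q a) := by
  have hprod : g (∏ a ∈ s, q a) ≠ 0 := by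
    rw [map_prod]
    exact Finset.prod_ne_zero_iff.2 hK
  refine mul_right_cancel₀ hprod ?_
  rw [sum_div_mul_prod g s p q hK, ← map_mul]
  congr 1
  apply hf
  rw [← sum_div_mul_prod f s p q hL, map_mul, h]

end Specialize

end Schroder

theorem mainTheorem3 (K : Type*) [Field K] (n : ℕ) (i j : Fin n) (hij : j < i) :
    ((∀ S ∈ Schroder.schroderPaths n (Schroder.idx j) (Schroder.idx i - 1),
        Schroder.weightDenom (Schroder.genericMatrix K n) (Schroder.idx j) S ≠ 0) ∧
      Schroder.genericMatrix K n i j =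
        ∑ S ∈ Schroder.schroderPaths n (Schroder.idx j) (Schroder.idx i - 1),
          Schroder.weight (Schroder.genericMatrix K n) (Schroder.idx j) S) ∧
    ∀ X : Matrix (Fin n) (Fin n) K,
      (∀ S ∈ Schroder.schroderPaths n (Schroder.idx j) (Schroder.idx i - 1),
        Schroder.weightDenom X (Schroder.idx j) S ≠ 0) →
      X i j = ∑ S ∈ Schroder.schroderPaths n (Schroder.idx j) (Schroder.idx i - 1),
        Schroder.weight X (Schroder.idx j) S := by
  have hinj := IsFractionRing.injective (MvPolynomial (Fin n × Fin n) K)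
    (FractionRing (MvPolynomial (Fin n × Fin n) K))
  have hN : ∀ v, Schroder.nodeLabel (Schroder.genericMatrix K n) v ≠ 0 := fun v => by
    rw [Schroder.genericMatrix, Schroder.nodeLabel_map]
    exact (map_ne_zero_iff _ hinj).2 (Schroder.nodeLabel_mvPolynomialX_ne_zero K v)
  have hE : ∀ v, Schroder.edgeLabel (Schroder.genericMatrix K n) v ≠ 0 := fun v => by
    rw [Schroder.genericMatrix, Schroder.edgeLabel_map]
    exact (map_ne_zero_iff _ hinj).2 (Schroder.edgeLabel_mvPolynomialX_ne_zero K v)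
  have hden := Schroder.weightDenom_ne_zero _ (Schroder.genericMatrix K n) hN hE (Schroder.idx j)
  have hsum := Schroder.sum_weight_eq hN hE hij
  refine ⟨⟨fun S _ => hden S, hsum⟩, fun X hX => ?_⟩
  -- Individual labels of `X` may vanish, so the recursion cannot be run for `X`; evaluating the
  -- generic identity at its entries needs only the path denominators.
  set g := MvPolynomial.eval fun p : Fin n × Fin n => X p.1 p.2
  have hg : (Matrix.mvPolynomialX (Fin n) (Fin n) K).map g = X := by
    ext a b
    simp [g]
  have key := Schroder.specialize_sum_div hinj g
    (Schroder.schroderPaths n (Schroder.idx j) (Schroder.idx i - 1))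
    (Matrix.mvPolynomialX (Fin n) (Fin n) K i j)
    (Schroder.weightNum (Matrix.mvPolynomialX (Fin n) (Fin n) K) (Schroder.idx j))
    (Schroder.weightDenom (Matrix.mvPolynomialX (Fin n) (Fin n) K) (Schroder.idx j))
  simp only [← Schroder.weightNum_map, ← Schroder.weightDenom_map, hg] at key
  have hgX : g (Matrix.mvPolynomialX (Fin n) (Fin n) K i j) = X i j := by simp [g]
  rw [hgX] at key
  exact key (fun S _ => hden S) hX hsum
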